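/- All graphs are finite and simple, not necessarily connected. A \emph{drawing} of a graph $G$ in the plane $\mathbb{R}^2$ represents the vertices by distinct points and every edge by an arc (a subset of the plane that is a union of finitely many straight line segments and is homeomorphic to $[0,1]$) joining the points of its two ends and containing no other vertex. A point that lies in the interior (the arc without its ends) of two different edges is a \emph{crossing} of these two edges. The drawing is \emph{1-planar} if adjacent edges do not cross and every edge is crossed at most once, that is, by at most one other edge and in at most one point. A graph is \emph{1-planar} if it has a 1-planar drawing. The \emph{planarization} $D^\times$ of a 1-planar drawing $D$ is the plane graph obtained from $D$ by making every crossing a new vertex, which subdivides the two edges that cross there; its \emph{outer face} is the unbounded connected component of $\mathbb{R}^2\setminus D^\times$. A graph $G$ is \emph{outer-1-planar} if it has a 1-planar drawing $D$ such that all vertices of $G$ lie on the boundary of the outer face of $D^\times$. The join $G+P_1$ of $G$ with the one-vertex graph $P_1$ is obtained from $G$ by adding one new vertex and joining it to all vertices of $G$. \textbf{Proposition.} If $G$ is outer-1-planar, then $G+P_1$ is 1-planar. -/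

import Mathlib

/-- The join `G + H`: disjoint copies of `G` and `H` together with all edges between them. -/
def graphJoin {V W : Type*} (G : SimpleGraph V) (H : SimpleGraph W) : SimpleGraph (V ⊕ W) :=
  (G ⊕g H) ⊔ completeBipartiteGraph V W

/-- The Euclidean plane. -/
abbrev Plane : Type := EuclideanSpace ℝ (Fin 2)

/-- `A` is a (polygonal) arc with ends `p` and `q`: a union of finitely many straight line
segments that is homeomorphic to `[0, 1]`, the homeomorphism taking `0` to `p` and `1` to `q`. -/
def IsArcBetween (A : Set Plane) (p q : Plane) : Prop :=
  (∃ S : Set (Plane × Plane), S.Finite ∧ A = ⋃ s ∈ S, segment ℝ s.1 s.2) ∧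
  ∃ γ : unitInterval → Plane, Continuous γ ∧ Function.Injective γ ∧
    γ 0 = p ∧ γ 1 = q ∧ Set.range γ = A

/-- A drawing of a graph in the plane: the vertices are distinct points, every edge is an arc
between its two ends (so no edge crosses itself), and the only vertices on the arc of an edge
are the two ends of that edge. -/
structure Drawing {V : Type*} (G : SimpleGraph V) where
  pos : V → Plane
  arc : G.edgeSet → Set Plane
  pos_injective : Function.Injective pos
  isArc : ∀ (u v : V) (h : G.Adj u v), IsArcBetween (arc ⟨s(u, v), h⟩) (pos u) (pos v)
  vertex_on_arc : ∀ (e : G.edgeSet) (v : V), pos v ∈ arc e → v ∈ e.1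

namespace Drawing

/-- The interior of (the arc of) an edge: the arc without its two ends. -/
def inner {V : Type*} {G : SimpleGraph V} (D : Drawing G) (e : G.edgeSet) : Set Plane :=
  D.arc e \ D.pos '' {v | v ∈ e.1}

/-- Edges `e` and `f` cross at `z`: they are different and `z` is a common interior point. -/
def CrossAt {V : Type*} {G : SimpleGraph V} (D : Drawing G) (e f : G.edgeSet) (z : Plane) : Prop :=
  e ≠ f ∧ z ∈ D.inner e ∧ z ∈ D.inner f

/-- A 1-planar drawing: adjacent edges do not cross, and every edge is crossed at most once,
that is, by at most one other edge and in at most one point. -/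
structure IsOnePlanar {V : Type*} {G : SimpleGraph V} (D : Drawing G) : Prop where
  adjacent_not_cross : ∀ (e f : G.edgeSet) (v : V), v ∈ e.1 → v ∈ f.1 → ∀ z, ¬ D.CrossAt e f z
  crossed_at_most_once : ∀ (e f f' : G.edgeSet) (z z' : Plane),
    D.CrossAt e f z → D.CrossAt e f' z' → f = f' ∧ z = z'

/-- The vertices of the planarization: the (true) vertices and the crossings (false vertices). -/
def planarizationVertices {V : Type*} {G : SimpleGraph V} (D : Drawing G) : Set Plane :=
  Set.range D.pos ∪ {z | ∃ e f, D.CrossAt e f z}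

/-- The edges of the planarization, as open arcs (without their ends): the pieces into which the
edges of the drawing are cut by the vertices of the planarization. -/
def planarizationEdges {V : Type*} {G : SimpleGraph V} (D : Drawing G) : Set (Set Plane) :=
  {A | ∃ e, ∃ x ∈ D.arc e \ D.planarizationVertices,
    A = connectedComponentIn (D.arc e \ D.planarizationVertices) x}

/-- The set of points of the plane that lie on the planarization. -/
def planarizationPoints {V : Type*} {G : SimpleGraph V} (D : Drawing G) : Set Plane :=
  D.planarizationVertices ∪ ⋃₀ D.planarizationEdges

/-- The planarization covers the same points as the drawing itself. -/
theorem planarizationPoints_eq {V : Type*} {G : SimpleGraph V} (D : Drawing G) :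
    D.planarizationPoints = Set.range D.pos ∪ ⋃ e, D.arc e := by
  ext x
  constructor
  · rintro ((hx | ⟨e, f, hx⟩) | ⟨A, ⟨e, y, hy, rfl⟩, hx⟩)
    · exact Or.inl hx
    · exact Or.inr (Set.mem_iUnion.2 ⟨e, hx.2.1.1⟩)
    · exact Or.inr (Set.mem_iUnion.2 ⟨e, (connectedComponentIn_subset _ _ hx).1⟩)
  · rintro (hx | hx)
    · exact Or.inl (Or.inl hx)
    · obtain ⟨e, hx⟩ := Set.mem_iUnion.1 hx
      by_cases h : x ∈ D.planarizationVertices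
      · exact Or.inl h
      · exact Or.inr ⟨_, ⟨e, x, ⟨hx, h⟩, rfl⟩, mem_connectedComponentIn ⟨hx, h⟩⟩

/-- `F` is the outer face of the planarization: the unbounded connected component of the
complement of the planarization. -/
def IsOuterFace {V : Type*} {G : SimpleGraph V} (D : Drawing G) (F : Set Plane) : Prop :=
  (∃ x ∈ D.planarizationPointsᶜ, F = connectedComponentIn D.planarizationPointsᶜ x) ∧
    ¬ Bornology.IsBounded F

end Drawing

/-- A graph is 1-planar if it has a 1-planar drawing. -/
def IsOnePlanarGraph {V : Type*} (G : SimpleGraph V) : Prop :=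
  ∃ D : Drawing G, D.IsOnePlanar

/-- A graph is outer-1-planar if it has a 1-planar drawing such that all its vertices lie on (the
boundary of) the outer face of the planarization. -/
def IsOuterOnePlanarGraph {V : Type*} (G : SimpleGraph V) : Prop :=
  ∃ D : Drawing G, D.IsOnePlanar ∧ ∃ F, D.IsOuterFace F ∧ ∀ v, D.pos v ∈ frontier F

open Set Topology Filter

/-! Put the new vertex at a point `p` of the outer face and join it to all old vertices by arcs that
run inside the face and pairwise meet only at `p`. These arcs meet the old drawing only at their
ends, so no crossing is created.

The work is the existence of such a star (`exists_star`), built one arc at a time. Removing a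
partial star may split the face, so a component touching the next vertex must also touch `p`
(`center_mem_closure_component`). If it did not, its boundary inside the face would contain a point
of some arc of the star, and being in its closure would propagate along that arc to `p`. The
propagation is local (`mem_closure_of_locally_arc`): near a point, a polygonal set is a union of
rays, and an arc has at most two of them there (`not_triod`), so from any sector one can turn to
each ray without crossing another. Inside the component a polygonal path is then made simple by
erasing loops (`PolyArc.extend`). -/

/-! ### Polygonal arcs and loop erasure -/

theorem IsArcBetween.symm {A : Set Plane} {p q : Plane} (h : IsArcBetween A p q) :
    IsArcBetween A q p := by
  obtain ⟨hS, γ, hc, hi, h0, h1, hr⟩ := h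
  refine ⟨hS, γ ∘ unitInterval.symm, hc.comp unitInterval.continuous_symm,
    hi.comp unitInterval.symm_bijective.injective, by simp [h1], by simp [h0], ?_⟩
  rw [range_comp, unitInterval.symm_bijective.surjective.range_eq, image_univ, hr]

theorem isArcBetween_segment {p q : Plane} (h : p ≠ q) : IsArcBetween (segment ℝ p q) p q := by
  refine ⟨⟨{(p, q)}, finite_singleton _, by simp⟩,
    fun t => AffineMap.lineMap p q (t : ℝ), by fun_prop, ?_, by simp, by simp, ?_⟩
  · exact (AffineMap.lineMap_injective ℝ h).comp Subtype.val_injective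
  · rw [segment_eq_image_lineMap]
    ext z
    simp [unitInterval]

/-- Two arcs that share only a common end form an arc. -/
theorem IsArcBetween.union {A B : Set Plane} {p q r : Plane} (hA : IsArcBetween A p q)
    (hB : IsArcBetween B q r) (h : A ∩ B ⊆ {q}) : IsArcBetween (A ∪ B) p r := by
  obtain ⟨⟨S, hS, hAS⟩, γ, hc, hi, h0, h1, hr⟩ := hA
  obtain ⟨⟨T, hT, hBT⟩, δ, hc', hi', h0', h1', hr'⟩ := hB
  refine ⟨⟨S ∪ T, hS.union hT, by rw [hAS, hBT, biUnion_union]⟩, ?_⟩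
  let P : Path p q := ⟨⟨γ, hc⟩, h0, h1⟩
  let Q : Path q r := ⟨⟨δ, hc'⟩, h0', h1'⟩
  have hPi : Function.Injective P := hi
  have hQi : Function.Injective Q := hi'
  have hPr : range P = A := hr
  have hQr : range Q = B := hr'
  refine ⟨P.trans Q, (P.trans Q).continuous, ?_, by simp, by simp, ?_⟩
  · have key : ∀ (s t : unitInterval), (s : ℝ) ≤ 1 / 2 → ¬ (t : ℝ) ≤ 1 / 2 →
        P.trans Q s ≠ P.trans Q t := by
      intro s t hs ht hst
      rw [Path.trans_apply, Path.trans_apply, dif_pos hs, dif_neg ht] at hst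
      have hq := h ⟨hPr.subset (mem_range_self _), hQr.subset ⟨_, hst.symm⟩⟩
      rw [mem_singleton_iff, hst] at hq
      have := hQi (hq.trans Q.source.symm)
      have := congrArg Subtype.val this
      simp at this
      push Not at ht
      linarith
    intro s t hst
    by_cases hs : (s : ℝ) ≤ 1 / 2 <;> by_cases ht : (t : ℝ) ≤ 1 / 2
    · rw [Path.trans_apply, Path.trans_apply, dif_pos hs, dif_pos ht] at hst
      have := congrArg Subtype.val (hPi hst)
      ext
      simpa using this
    · exact (key s t hs ht hst).elim
    · exact (key t s ht hs hst.symm).elim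
    · rw [Path.trans_apply, Path.trans_apply, dif_neg hs, dif_neg ht] at hst
      have := congrArg Subtype.val (hQi hst)
      ext
      simpa using this
  · rw [Path.trans_range, hPr, hQr]

/-- Simple polygonal chains, built by appending segments. -/
inductive PolyArc (p : Plane) : Set Plane → Plane → Prop
  | base {q : Plane} : p ≠ q → PolyArc p (segment ℝ p q) q
  | append {A : Set Plane} {q r : Plane} : PolyArc p A q → q ≠ r → A ∩ segment ℝ q r ⊆ {q} →
      PolyArc p (A ∪ segment ℝ q r) r

theorem PolyArc.isArcBetween {p q : Plane} {A : Set Plane} (h : PolyArc p A q) :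
    IsArcBetween A p q := by
  induction h with
  | base h => exact isArcBetween_segment h
  | append _ h h' ih => exact ih.union (isArcBetween_segment h) h'

theorem PolyArc.truncate {p q z : Plane} {A : Set Plane} (h : PolyArc p A q) (hz : z ∈ A)
    (hzp : z ≠ p) : ∃ B ⊆ A, PolyArc p B z := by
  induction h with
  | @base q h =>
    exact ⟨segment ℝ p z, (convex_segment p q).segment_subset (left_mem_segment ℝ p q) hz,
      .base hzp.symm⟩
  | @append A q r hA h h' ih =>
    by_cases hzA : z ∈ A
    · obtain ⟨B, hB, hB'⟩ := ih hzA
      exact ⟨B, hB.trans subset_union_left, hB'⟩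
    · have hz' : z ∈ segment ℝ q r := hz.resolve_left hzA
      have hs : segment ℝ q z ⊆ segment ℝ q r :=
        (convex_segment q r).segment_subset (left_mem_segment ℝ q r) hz'
      have hq : q ∈ A := by
        obtain ⟨-, γ, -, -, -, h1, hr⟩ := hA.isArcBetween
        exact hr ▸ h1 ▸ mem_range_self _
      refine ⟨A ∪ segment ℝ q z, union_subset_union_right _ hs, hA.append ?_ ?_⟩
      · rintro rfl
        exact hzA hq
      · exact (inter_subset_inter_right _ hs).trans h'

theorem IsArcBetween.isCompact {A : Set Plane} {p q : Plane} (h : IsArcBetween A p q) :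
    IsCompact A := by
  obtain ⟨-, γ, hc, -, -, -, hr⟩ := h
  exact hr ▸ isCompact_range hc

theorem IsArcBetween.left_mem {A : Set Plane} {p q : Plane} (h : IsArcBetween A p q) : p ∈ A := by
  obtain ⟨-, γ, -, -, h0, -, hr⟩ := h
  exact hr ▸ h0 ▸ mem_range_self _

theorem IsArcBetween.right_mem {A : Set Plane} {p q : Plane} (h : IsArcBetween A p q) : q ∈ A :=
  h.symm.left_mem

/-- Loop erasure: leave the chain at the last point `z` of the new segment that lies on it, and go
straight from `z` to `c`. If `z = p`, the whole old chain is dropped; if `z = c`, truncation alone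
suffices. -/
theorem PolyArc.extend {p q c : Plane} {A : Set Plane} (h : PolyArc p A q) (hc : c ≠ p) :
    ∃ B ⊆ A ∪ segment ℝ q c, PolyArc p B c := by
  obtain ⟨t, ⟨ht, htA⟩, hmax⟩ : ∃ t ∈ Icc (0 : ℝ) 1 ∩ AffineMap.lineMap q c ⁻¹' A,
      ∀ s ∈ Icc (0 : ℝ) 1 ∩ AffineMap.lineMap q c ⁻¹' A, s ≤ t := by
    have hcomp : IsCompact (Icc (0 : ℝ) 1 ∩ AffineMap.lineMap q c ⁻¹' A) :=
      isCompact_Icc.inter_right (h.isArcBetween.isCompact.isClosed.preimage (by fun_prop))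
    exact hcomp.exists_isGreatest ⟨0, by simp, by simpa using h.isArcBetween.right_mem⟩
  set z : Plane := AffineMap.lineMap q c t with hz
  have hzs : z ∈ segment ℝ q c := by
    rw [segment_eq_image_lineMap]
    exact mem_image_of_mem _ ht
  have hsub : segment ℝ z c ⊆ segment ℝ q c :=
    (convex_segment q c).segment_subset hzs (right_mem_segment ℝ q c)
  by_cases hzc : z = c
  · obtain ⟨B, hB, hB'⟩ := h.truncate htA (by rwa [← hz, hzc])
    exact ⟨B, hB.trans subset_union_left, hzc ▸ hB'⟩
  by_cases hzp : z = p
  · exact ⟨segment ℝ p c, (hzp ▸ hsub).trans subset_union_right, .base hc.symm⟩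
  obtain ⟨B, hB, hB'⟩ := h.truncate htA hzp
  refine ⟨B ∪ segment ℝ z c, union_subset_union hB hsub, hB'.append hzc ?_⟩
  rintro w ⟨hwB, hw⟩
  rw [segment_eq_image_lineMap] at hw
  obtain ⟨s, hs, rfl⟩ := hw
  -- A later meeting with the chain, rewritten in the parameter of the segment from `q` to `c`,
  -- contradicts the maximality of `t` unless `s = 0`.
  have hw' : AffineMap.lineMap z c s = AffineMap.lineMap q c (t + s * (1 - t)) := by
    rw [hz]
    simp only [AffineMap.lineMap_apply_module]
    module
  have := hmax (t + s * (1 - t)) ⟨⟨by nlinarith [hs.1, ht.1, ht.2, mul_nonneg hs.1 (sub_nonneg.2 ht.2)],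
    by nlinarith [hs.2, ht.2, mul_nonneg (sub_nonneg.2 hs.2) (sub_nonneg.2 ht.2)]⟩, by
    rw [mem_preimage, ← hw']
    exact hB hwB⟩
  have ht1 : t ≠ 1 := by
    rintro rfl
    simp at hz
    exact hzc hz
  have ht1' : 0 < 1 - t := sub_pos.2 (lt_of_le_of_ne ht.2 ht1)
  have : s = 0 := le_antisymm (by by_contra! hs0; nlinarith [mul_pos hs0 ht1']) hs.1
  simp [this]

/-- Two points joined by a polygonal path in `W` are joined by a polygonal arc in `W`. -/
theorem exists_polyArc_of_reflTransGen {W : Set Plane} {p q : Plane}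
    (h : Relation.ReflTransGen (fun x y => segment ℝ x y ⊆ W) p q) (hpq : p ≠ q) :
    ∃ A ⊆ W, PolyArc p A q := by
  induction h with
  | refl => exact (hpq rfl).elim
  | @tail b c _ hbc ih =>
    by_cases hb : p = b
    · subst hb
      exact ⟨_, hbc, .base hpq⟩
    · obtain ⟨A, hA, hA'⟩ := ih hb
      obtain ⟨B, hB, hB'⟩ := hA'.extend hpq.symm
      exact ⟨B, hB.trans (union_subset hA hbc), hB'⟩

/-- Open connected sets are polygonally connected. -/
theorem IsPreconnected.reflTransGen_segment {U : Set Plane} (hU : IsPreconnected U)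
    (ho : IsOpen U) {x y : Plane} (hx : x ∈ U) (hy : y ∈ U) :
    Relation.ReflTransGen (fun x y => segment ℝ x y ⊆ U) x y := by
  refine hU.induction₂ (Relation.ReflTransGen (fun x y => segment ℝ x y ⊆ U)) ?_
    (fun a b c _ _ _ h h' => h.trans h') ?_ hx hy
  · intro a ha
    obtain ⟨r, hr, hrU⟩ := Metric.isOpen_iff.1 ho a ha
    filter_upwards [mem_nhdsWithin_of_mem_nhds (Metric.ball_mem_nhds a hr)] with b hb
    exact .single (((convex_ball a r).segment_subset (Metric.mem_ball_self hr) hb).trans hrU)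
  · intro a b _ _ h
    have : Std.Symm fun x y : Plane => segment ℝ x y ⊆ U :=
      ⟨fun u v huv => by rwa [segment_symm]⟩
    exact Std.Symm.symm _ _ h

/-! ### Triods do not embed in arcs -/

/-- A set consisting of three segments with a common end cannot be embedded in an arc. -/
theorem not_triod {γ : unitInterval → Plane} (hc : Continuous γ) (hi : Function.Injective γ)
    (t : unitInterval) (R : Fin 3 → Set Plane) (hR : ∀ i, R i ⊆ range γ)
    (hpre : ∀ i, IsPreconnected (R i)) (hcl : ∀ i, γ t ∈ closure (R i))
    (hnot : ∀ i, γ t ∉ R i) (hdisj : Pairwise fun i j => Disjoint (R i) (R j)) : False := by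
  have hemb : IsInducing γ := (hc.isClosedEmbedding hi).isInducing
  let J : Fin 3 → Set unitInterval := fun i => γ ⁻¹' R i
  have hJR : ∀ i, γ '' J i = R i := fun i => image_preimage_eq_of_subset (hR i)
  have hJ : ∀ i, (J i).OrdConnected := fun i =>
    (hemb.isPreconnected_image.1 ((hJR i).symm ▸ hpre i)).ordConnected
  have hJt : ∀ i, t ∈ closure (J i) := fun i => by
    rw [hemb.closure_eq_preimage_closure_image, hJR]
    exact hcl i
  have hJn : ∀ i, t ∉ J i := hnot
  have hJd : ∀ i j, i ≠ j → ∀ a, a ∈ J i → a ∉ J j := fun i j hij a ha hb =>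
    disjoint_left.1 (hdisj hij) ha hb
  have hne : ∀ i, (J i).Nonempty := fun i => closure_nonempty_iff.1 ⟨t, hJt i⟩
  -- Each preimage is an interval that omits `t` but accumulates there, so it lies on one side of
  -- `t`. Two on the same side would overlap, and there are three intervals for two sides.
  have hside : ∀ i, (∀ a ∈ J i, a < t) ∨ (∀ a ∈ J i, t < a) := by
    intro i
    by_contra! h
    obtain ⟨⟨a, ha, hat⟩, b, hb, hbt⟩ := h
    exact hJn i ((hJ i).out hb ha ⟨hbt, hat⟩)
  have hlow : ∀ i j, i ≠ j → (∀ a ∈ J i, a < t) → ¬ (∀ a ∈ J j, a < t) := by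
    intro i j hij h1 h2
    obtain ⟨a, ha⟩ := hne i
    obtain ⟨b, hab, hb⟩ := mem_closure_iff.1 (hJt j) (Ioi a) isOpen_Ioi (h1 a ha)
    obtain ⟨c, hbc, hc⟩ := mem_closure_iff.1 (hJt i) (Ioi b) isOpen_Ioi (h2 b hb)
    exact hJd i j hij b ((hJ i).out ha hc ⟨le_of_lt hab, le_of_lt hbc⟩) hb
  have hhigh : ∀ i j, i ≠ j → (∀ a ∈ J i, t < a) → ¬ (∀ a ∈ J j, t < a) := by
    intro i j hij h1 h2
    obtain ⟨a, ha⟩ := hne i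
    obtain ⟨b, hab, hb⟩ := mem_closure_iff.1 (hJt j) (Iio a) isOpen_Iio (h1 a ha)
    obtain ⟨c, hbc, hc⟩ := mem_closure_iff.1 (hJt i) (Iio b) isOpen_Iio (h2 b hb)
    exact hJd i j hij b ((hJ i).out hc ha ⟨le_of_lt hbc, le_of_lt hab⟩) hb
  have h01 : (0 : Fin 3) ≠ 1 := by decide
  have h02 : (0 : Fin 3) ≠ 2 := by decide
  have h12 : (1 : Fin 3) ≠ 2 := by decide
  rcases hside 0 with h0 | h0 <;> rcases hside 1 with h1 | h1 <;> rcases hside 2 with h2 | h2 <;>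
    first
    | exact hlow 0 1 h01 h0 h1
    | exact hlow 0 2 h02 h0 h2
    | exact hlow 1 2 h12 h1 h2
    | exact hhigh 0 1 h01 h0 h1
    | exact hhigh 0 2 h02 h0 h2
    | exact hhigh 1 2 h12 h1 h2

/-! ### Polygonal sets and their local conic structure -/

/-- A finite union of segments. -/
def IsPolygonal (L : Set Plane) : Prop :=
  ∃ S : Set (Plane × Plane), S.Finite ∧ L = ⋃ s ∈ S, segment ℝ s.1 s.2

theorem IsPolygonal.union {L M : Set Plane} (hL : IsPolygonal L) (hM : IsPolygonal M) :
    IsPolygonal (L ∪ M) := by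
  obtain ⟨S, hS, rfl⟩ := hL
  obtain ⟨T, hT, rfl⟩ := hM
  exact ⟨S ∪ T, hS.union hT, by rw [biUnion_union]⟩

theorem isPolygonal_singleton (p : Plane) : IsPolygonal {p} :=
  ⟨{(p, p)}, finite_singleton _, by simp⟩

theorem isPolygonal_empty : IsPolygonal ∅ := ⟨∅, finite_empty, by simp⟩

theorem IsPolygonal.biUnion {ι : Type*} (s : Finset ι) (A : ι → Set Plane)
    (h : ∀ i ∈ s, IsPolygonal (A i)) : IsPolygonal (⋃ i ∈ s, A i) := by
  classical
  induction s using Finset.induction_on with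
  | empty => simpa using isPolygonal_empty
  | insert a s _ ih =>
    rw [Finset.set_biUnion_insert]
    exact (h a (by simp)).union (ih fun i hi => h i (by simp [hi]))

theorem IsPolygonal.isClosed {L : Set Plane} (h : IsPolygonal L) : IsClosed L := by
  obtain ⟨S, hS, rfl⟩ := h
  refine hS.isClosed_biUnion fun s _ => ?_
  rw [segment_eq_image_lineMap]
  exact (isCompact_Icc.image (by fun_prop)).isClosed

/-- Near `x`, membership in a segment depends only on the direction from `x`: away from the segment
both sides are false, and on it convexity gives one implication. The converse needs `w` to be too
close to `x` to overshoot an end of the segment. -/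
theorem segment_locally_conic (a b x : Plane) : ∀ᶠ w in 𝓝 x, ∀ t ∈ Ioc (0 : ℝ) 1,
    (AffineMap.lineMap x w t ∈ segment ℝ a b ↔ w ∈ segment ℝ a b) := by
  by_cases hx : x ∈ segment ℝ a b
  swap
  · have hcl : IsClosed (segment ℝ a b) := by
      rw [segment_eq_image_lineMap]
      exact (isCompact_Icc.image (by fun_prop)).isClosed
    obtain ⟨r, hr, hr'⟩ := Metric.isOpen_iff.1 hcl.isOpen_compl x hx
    filter_upwards [Metric.ball_mem_nhds x hr] with w hw t ht
    have h1 : AffineMap.lineMap x w t ∈ Metric.ball x r := by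
      apply (convex_ball x r).segment_subset (Metric.mem_ball_self hr) hw
      rw [segment_eq_image_lineMap]
      exact mem_image_of_mem _ ⟨ht.1.le, ht.2⟩
    exact iff_of_false (hr' h1) (hr' hw)
  have hforw : ∀ w ∈ segment ℝ a b, ∀ t ∈ Ioc (0 : ℝ) 1,
      AffineMap.lineMap x w t ∈ segment ℝ a b := by
    intro w hw t ht
    apply (convex_segment a b).segment_subset hx hw
    rw [segment_eq_image_lineMap]
    exact mem_image_of_mem _ ⟨ht.1.le, ht.2⟩
  rcases eq_or_ne a b with rfl | hab
  · filter_upwards with w t ht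
    refine ⟨fun h => ?_, fun h => hforw w h t ht⟩
    simp only [segment_same, mem_singleton_iff] at hx h ⊢
    subst hx
    rw [AffineMap.lineMap_apply_module', add_eq_right, smul_eq_zero] at h
    exact sub_eq_zero.1 (h.resolve_left ht.1.ne')
  rw [segment_eq_image'] at hx
  obtain ⟨l, ⟨hl0, hl1⟩, rfl⟩ := hx
  have hba : 0 < ‖b - a‖ := norm_pos_iff.2 (sub_ne_zero.2 hab.symm)
  -- Only ends of `[0, 1]` different from `l` bound `ε`; at an end equal to `l`, the sign of `m - l`
  -- keeps the parameter inside.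
  obtain ⟨ε, hε, hε0, hε1⟩ : ∃ ε > 0, (0 < l → ε ≤ l) ∧ (l < 1 → ε ≤ 1 - l) := by
    rcases hl0.eq_or_lt with h0 | h0 <;> rcases hl1.eq_or_lt with h1 | h1
    · exact ⟨1, one_pos, fun h => by linarith, fun h => by linarith⟩
    · exact ⟨1 - l, by linarith, fun h => by linarith, fun h => le_rfl⟩
    · exact ⟨l, h0, fun h => le_rfl, fun h => by linarith⟩
    · exact ⟨min l (1 - l), lt_min h0 (by linarith), fun _ => min_le_left _ _,
        fun _ => min_le_right _ _⟩
  filter_upwards [Metric.ball_mem_nhds _ (mul_pos hε hba)] with w hw t ht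
  refine ⟨fun h => ?_, fun h => hforw w h t ht⟩
  rw [segment_eq_image'] at h ⊢
  obtain ⟨m, ⟨hm0, hm1⟩, hm⟩ := h
  have hw' : w = a + (l + (m - l) / t) • (b - a) := by
    simp only [AffineMap.lineMap_apply_module'] at hm
    have h2 : t • (w - (a + l • (b - a))) = (m - l) • (b - a) := by
      rw [eq_sub_of_add_eq hm.symm]; module
    have h3 : w - (a + l • (b - a)) = ((m - l) / t) • (b - a) := by
      rw [div_eq_inv_mul, mul_smul, ← h2, smul_smul, inv_mul_cancel₀ ht.1.ne', one_smul]
    rw [sub_eq_iff_eq_add.1 h3]; module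
  have hlt : |(m - l) / t| < ε := by
    rw [hw', Metric.mem_ball, dist_eq_norm] at hw
    have : a + (l + (m - l) / t) • (b - a) - (a + l • (b - a)) = ((m - l) / t) • (b - a) := by
      module
    simp only [this, norm_smul, Real.norm_eq_abs] at hw
    exact lt_of_mul_lt_mul_right hw hba.le
  rw [abs_lt] at hlt
  refine ⟨l + (m - l) / t, ⟨?_, ?_⟩, hw'.symm⟩
  · rcases hl0.eq_or_lt with h0 | h0
    · rw [← h0, sub_zero, zero_add]
      exact div_nonneg hm0 ht.1.le
    · linarith [hε0 h0]
  · rcases hl1.eq_or_lt with h1 | h1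
    · have : (m - l) / t ≤ 0 := div_nonpos_of_nonpos_of_nonneg (by linarith) ht.1.le
      linarith
    · linarith [hε1 h1]

theorem IsPolygonal.locally_conic {L : Set Plane} (hL : IsPolygonal L) (x : Plane) :
    ∀ᶠ w in 𝓝 x, ∀ t ∈ Ioc (0 : ℝ) 1, (AffineMap.lineMap x w t ∈ L ↔ w ∈ L) := by
  obtain ⟨S, hS, rfl⟩ := hL
  filter_upwards [(eventually_all_finite hS).2 fun s _ => segment_locally_conic s.1 s.2 x]
    with w hw t ht
  simp only [mem_iUnion, exists_prop]
  exact exists_congr fun s => and_congr_right fun hs => hw s hs t ht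

/-! ### Polar coordinates and sectors around a point of an arc -/

/-- The unit vector of angle `φ`. -/
noncomputable def unitDir (φ : ℝ) : Plane := !₂[Real.cos φ, Real.sin φ]

theorem continuous_unitDir : Continuous unitDir := by
  unfold unitDir
  fun_prop

theorem norm_unitDir (φ : ℝ) : ‖unitDir φ‖ = 1 := by
  simp [unitDir, EuclideanSpace.norm_eq]

theorem exists_polar (w : Plane) : ∃ φ, w = ‖w‖ • unitDir φ := by
  refine ⟨Complex.arg ⟨w 0, w 1⟩, ?_⟩
  have hn : ‖w‖ = ‖(⟨w 0, w 1⟩ : ℂ)‖ := by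
    rw [EuclideanSpace.norm_eq, Complex.norm_eq_sqrt_sq_add_sq]
    simp
  ext i
  fin_cases i
  · simp [unitDir, hn]
  · simp [unitDir, hn]

theorem unitDir_add_int_mul (φ : ℝ) (k : ℤ) : unitDir (φ + k * (2 * Real.pi)) = unitDir φ := by
  simp [unitDir]

theorem unitDir_sub_two_pi (φ : ℝ) : unitDir (φ - 2 * Real.pi) = unitDir φ := by
  simp [unitDir]

theorem eq_of_smul_unitDir_eq {α β s t : ℝ} (hs : 0 < s) (ht : 0 < t)
    (h : s • unitDir α = t • unitDir β) (h1 : |α - β| < 2 * Real.pi) : α = β := by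
  have hst : s = t := by
    have := congrArg norm h
    simpa [norm_smul, norm_unitDir, abs_of_pos hs, abs_of_pos ht] using this
  subst hst
  have h' : unitDir α = unitDir β := smul_right_injective _ hs.ne' h
  have hcos : Real.cos α = Real.cos β := by simpa [unitDir] using congrArg (fun v : Plane => v 0) h'
  have hsin : Real.sin α = Real.sin β := by simpa [unitDir] using congrArg (fun v : Plane => v 1) h'
  have : Real.cos (α - β) = 1 := by
    rw [Real.cos_sub, hcos, hsin]
    nlinarith [Real.sin_sq_add_cos_sq β]
  rw [abs_lt] at h1
  linarith [(Real.cos_eq_one_iff_of_lt_of_lt (by linarith) (by linarith)).1 this]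

/-- Near a point `z` of an arc where `L` is conic and contained in the arc, a set `U` that is
saturated with respect to connected subsets of the complement of `L` accumulates at all points
of `L` as soon as it accumulates at `z`. -/
theorem mem_closure_of_locally_arc {L U : Set Plane} {z w : Plane} {r : ℝ}
    {γ : unitInterval → Plane} (hc : Continuous γ) (hi : Function.Injective γ)
    (hz : z ∈ range γ) (hLγ : ∀ w ∈ Metric.ball z r, w ∈ L → w ∈ range γ)
    (hconic : ∀ w ∈ Metric.ball z r, ∀ t ∈ Ioc (0 : ℝ) 1,
      (AffineMap.lineMap z w t ∈ L ↔ w ∈ L))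
    (hUL : U ⊆ Lᶜ) (hU : ∀ C : Set Plane, IsPreconnected C → C ⊆ Lᶜ → (C ∩ U).Nonempty → C ⊆ U)
    (hr : 0 < r) (hzU : z ∈ closure U) (hzL : z ∈ L) (hw : w ∈ Metric.ball z r) (hwL : w ∈ L) :
    w ∈ closure U := by
  rcases eq_or_ne w z with rfl | hwz
  · exact hzU
  obtain ⟨t, rfl⟩ := hz
  set z := γ t
  have hball : ∀ s ∈ Ioo 0 r, ∀ φ, z + s • unitDir φ ∈ Metric.ball z r := by
    intro s hs φ
    simpa [dist_eq_norm, norm_smul, norm_unitDir, abs_of_pos hs.1] using hs.2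
  -- Conicity makes `L` within the ball a union of whole open rays, apart from `z` itself.
  have hray : ∀ φ, ∀ s ∈ Ioo 0 r, ∀ s' ∈ Ioo 0 r,
      z + s • unitDir φ ∈ L → z + s' • unitDir φ ∈ L := by
    have hle : ∀ φ, ∀ s ∈ Ioo 0 r, ∀ s' ∈ Ioo 0 r, s ≤ s' →
        (z + s • unitDir φ ∈ L ↔ z + s' • unitDir φ ∈ L) := by
      intro φ s hs s' hs' hss
      rw [← hconic _ (hball s' hs' φ) (s / s') ⟨div_pos hs.1 hs'.1, (div_le_one hs'.1).2 hss⟩,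
        AffineMap.lineMap_apply_module', add_sub_cancel_left, smul_smul,
        div_mul_cancel₀ _ hs'.1.ne', add_comm]
    intro φ s hs s' hs' h
    rcases le_total s s' with hss | hss
    · exact (hle φ s hs s' hs' hss).1 h
    · exact (hle φ s' hs' s hs hss).2 h
  obtain ⟨u, huz, huU⟩ := mem_closure_iff.1 hzU _ Metric.isOpen_ball (Metric.mem_ball_self hr)
  have huz' : u ≠ z := fun h => hUL huU (h ▸ hzL)
  obtain ⟨θ, hθ⟩ := exists_polar (u - z)
  obtain ⟨α', hα'⟩ := exists_polar (w - z)
  have hσ : ‖w - z‖ ∈ Ioo 0 r := ⟨norm_pos_iff.2 (sub_ne_zero.2 hwz), mem_ball_iff_norm.1 hw⟩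
  have hρ : ‖u - z‖ ∈ Ioo 0 r := ⟨norm_pos_iff.2 (sub_ne_zero.2 huz'), mem_ball_iff_norm.1 huz⟩
  set σ := ‖w - z‖
  set ρ := ‖u - z‖
  obtain ⟨α, hα, hαα⟩ : ∃ α ∈ Ioc θ (θ + 2 * Real.pi), unitDir α' = unitDir α := by
    refine ⟨_, toIocMod_mem_Ioc Real.two_pi_pos θ α', ?_⟩
    conv_lhs => rw [← toIocMod_add_toIocDiv_zsmul Real.two_pi_pos θ α', zsmul_eq_mul]
    rw [unitDir_add_int_mul]
  rw [hαα] at hα'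
  have hwe : w = z + σ • unitDir α := by rw [← hα']; abel
  have hue : u = z + ρ • unitDir θ := by rw [← hθ]; abel
  have huL : ∀ s ∈ Ioo 0 r, z + s • unitDir θ ∉ L := fun s hs h =>
    hUL huU (hue ▸ hray θ s hs ρ hρ h)
  have hα2 : α < θ + 2 * Real.pi := by
    refine lt_of_le_of_ne hα.2 fun h => huL σ hσ ?_
    rw [← unitDir_sub_two_pi α, h, add_sub_cancel_right] at hwe
    exact hwe ▸ hwL
  -- A sector free of `L` that contains the ray of `u` is connected, hence inside `U`; if its angles
  -- accumulate at the angle of `w`, then `w` is in its closure.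
  have hsector : ∀ I : Set ℝ, IsPreconnected I → θ ∈ I → α - 2 * Real.pi ∈ closure I ∨ α ∈ closure I →
      (∀ φ ∈ I, ∀ s ∈ Ioo 0 r, z + s • unitDir φ ∉ L) → w ∈ closure U := by
    intro I hI hθI hαI hfree
    let f : ℝ × ℝ → Plane := fun x => z + x.1 • unitDir x.2
    have hf : Continuous f :=
      continuous_const.add (continuous_fst.smul (continuous_unitDir.comp continuous_snd))
    have hCU : f '' (Ioo 0 r ×ˢ I) ⊆ U := by
      refine hU _ ((isPreconnected_Ioo.prod hI).image f hf.continuousOn) ?_ ?_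
      · rintro _ ⟨⟨s, φ⟩, ⟨hs, hφ⟩, rfl⟩
        exact hfree φ hφ s hs
      · exact ⟨u, ⟨(ρ, θ), ⟨hρ, hθI⟩, hue.symm⟩, huU⟩
    obtain ⟨β, hβ, hβw⟩ : ∃ β ∈ closure I, f (σ, β) = w := by
      rcases hαI with h | h
      · exact ⟨_, h, by simp only [f]; rw [unitDir_sub_two_pi, hwe]⟩
      · exact ⟨_, h, hwe.symm⟩
    refine closure_mono hCU (image_closure_subset_closure_image hf ⟨(σ, β), ?_, hβw⟩)
    rw [closure_prod_eq]
    exact ⟨subset_closure hσ, hβ⟩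
  -- Turn counterclockwise from `θ` to `α`; if a ray `β` of `L` blocks the way, turn clockwise to `α
  -- - 2π`. A second blocking ray `δ` would form a triod with `α` and `β`.
  by_cases hfree : ∀ φ ∈ Ico θ α, ∀ s ∈ Ioo 0 r, z + s • unitDir φ ∉ L
  · refine hsector (Ico θ α) isPreconnected_Ico ⟨le_rfl, hα.1⟩ (.inr ?_) hfree
    rw [closure_Ico hα.1.ne]
    exact ⟨hα.1.le, le_rfl⟩
  push Not at hfree
  obtain ⟨β, hβ, s, hs, hβL⟩ := hfree
  refine hsector (Ioc (α - 2 * Real.pi) θ) isPreconnected_Ioc ⟨by linarith, le_rfl⟩ (.inl ?_) ?_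
  · rw [closure_Ioc (by linarith)]
    exact ⟨le_rfl, by linarith⟩
  intro δ hδ s' hs' hδL
  have hδβ : δ < β := by
    refine lt_of_le_of_ne (hδ.2.trans hβ.1) ?_
    rintro rfl
    have : δ = θ := le_antisymm hδ.2 hβ.1
    exact huL s' hs' (this ▸ hδL)
  let a : Fin 3 → ℝ := ![α, β, δ]
  let R : Fin 3 → Set Plane := fun i => (fun s : ℝ => z + s • unitDir (a i)) '' Ioo 0 r
  have hcont : ∀ i, Continuous fun s : ℝ => z + s • unitDir (a i) := fun i => by fun_prop
  have haL : ∀ i, ∀ s ∈ Ioo 0 r, z + s • unitDir (a i) ∈ L := by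
    intro i s₀ hs₀
    fin_cases i
    · exact hray α σ hσ s₀ hs₀ (hwe ▸ hwL)
    · exact hray β s hs s₀ hs₀ hβL
    · exact hray δ s' hs' s₀ hs₀ hδL
  have hd : ∀ i j, |a i - a j| < 2 * Real.pi := by
    have := hβ.1; have := hβ.2; have := hδ.1; have := hδ.2
    intro i j
    fin_cases i <;> fin_cases j <;> simp only [a, abs_lt] <;> constructor <;> simp <;> linarith
  have hne : ∀ i j, i ≠ j → a i ≠ a j := by
    have := hβ.2
    intro i j hij h
    fin_cases i <;> fin_cases j <;> simp [a] at h hij <;> linarith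
  refine not_triod hc hi t R ?_ ?_ ?_ ?_ ?_
  · rintro i _ ⟨s₀, hs₀, rfl⟩
    exact hLγ _ (hball s₀ hs₀ _) (haL i s₀ hs₀)
  · exact fun i => isPreconnected_Ioo.image _ (hcont i).continuousOn
  · intro i
    refine image_closure_subset_closure_image (hcont i) ⟨0, ?_, by simp [z]⟩
    rw [closure_Ioo hr.ne]
    exact ⟨le_rfl, hr.le⟩
  · rintro i ⟨s₀, hs₀, h⟩
    have h' : z + s₀ • unitDir (a i) = z := h
    have := congrArg norm (add_eq_left.1 h')
    simp [norm_smul, norm_unitDir, hs₀.1.ne'] at this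
  · intro i j hij
    refine disjoint_left.2 ?_
    rintro _ ⟨s₁, hs₁, rfl⟩ ⟨s₂, hs₂, h⟩
    exact hne i j hij (eq_of_smul_unitDir_eq hs₁.1 hs₂.1 (add_left_cancel h).symm (hd i j))

/-! ### Stars inside a face -/

theorem subset_connectedComponentIn_of_inter {X : Type*} [TopologicalSpace X] {C L : Set X} {y : X}
    (hC : IsPreconnected C) (hCL : C ⊆ L) (h : (C ∩ connectedComponentIn L y).Nonempty) :
    C ⊆ connectedComponentIn L y := by
  obtain ⟨w, hw, hwy⟩ := h
  rw [connectedComponentIn_eq hwy]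
  exact hC.subset_connectedComponentIn hw hCL

/-- The segment without `a` is connected and, by conicity, misses `L`. This gives straight access
from a component to a point of its boundary, used at both ends of a new arc of the star. -/
theorem segment_subset_insert_connectedComponentIn {L : Set Plane} {a y y₀ : Plane}
    (hconic : ∀ t ∈ Ioc (0 : ℝ) 1, (AffineMap.lineMap a y t ∈ L ↔ y ∈ L))
    (hy : y ∈ connectedComponentIn Lᶜ y₀) :
    segment ℝ a y ⊆ insert a (connectedComponentIn Lᶜ y₀) := by
  have hsub : (fun t : ℝ => AffineMap.lineMap a y t) '' Ioc (0 : ℝ) 1 ⊆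
      connectedComponentIn Lᶜ y₀ := by
    refine subset_connectedComponentIn_of_inter ?_ ?_ ?_
    · exact isPreconnected_Ioc.image _ (by fun_prop)
    · rintro _ ⟨t, ht, rfl⟩ h
      exact connectedComponentIn_subset _ _ hy ((hconic t ht).1 h)
    · exact ⟨y, ⟨1, by simp, by simp⟩, hy⟩
  rw [segment_eq_image_lineMap]
  rintro _ ⟨t, ht, rfl⟩
  rcases ht.1.eq_or_lt with h | h
  · left
    simp [← h]
  · exact .inr (hsub ⟨t, ⟨h, ht.2⟩, rfl⟩)

/-- If a star of arcs centred at `p` is removed from a face, then `p` is on the boundary of every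
component that is left. -/
theorem center_mem_closure_component {K : Set Plane} (hK : IsPolygonal K) {x p y : Plane}
    (hp : p ∈ connectedComponentIn Kᶜ x) {s : Finset Plane} {A : Plane → Set Plane}
    (hs : ∀ v ∈ s, v ∈ K)
    (hA : ∀ v ∈ s, IsArcBetween (A v) v p ∧ A v ⊆ insert v (connectedComponentIn Kᶜ x))
    (hdisj : ∀ u ∈ s, ∀ v ∈ s, u ≠ v → A u ∩ A v ⊆ {p})
    (hyF : y ∈ connectedComponentIn Kᶜ x) (hyL : y ∉ K ∪ ({p} ∪ ⋃ v ∈ s, A v)) :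
    p ∈ closure (connectedComponentIn (K ∪ ({p} ∪ ⋃ v ∈ s, A v))ᶜ y) := by
  set F := connectedComponentIn Kᶜ x
  set L := K ∪ ({p} ∪ ⋃ v ∈ s, A v)
  set U := connectedComponentIn Lᶜ y
  have hLp : IsPolygonal L :=
    hK.union ((isPolygonal_singleton p).union (IsPolygonal.biUnion s A fun v hv => (hA v hv).1.1))
  have hUo : IsOpen U := hLp.isClosed.isOpen_compl.connectedComponentIn
  have hUL : U ⊆ Lᶜ := connectedComponentIn_subset _ _
  have hyU : y ∈ U := mem_connectedComponentIn hyL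
  have hFK : F ⊆ Kᶜ := connectedComponentIn_subset _ _
  have hpL : p ∈ L := .inr (.inl rfl)
  by_contra hpU
  -- Otherwise `U` and the complement of its closure would separate the connected set `F`, forcing
  -- `p ∈ U`.
  obtain ⟨w, hwF, hwc, hwU⟩ : ∃ w ∈ F, w ∈ closure U ∧ w ∉ U := by
    by_contra! h
    refine hUL ((isPreconnected_connectedComponentIn : IsPreconnected F).subset_left_of_subset_union
      (v := (closure U)ᶜ) hUo isClosed_closure.isOpen_compl ?_ ?_ ⟨y, hyF, hyU⟩ hp) hpL
    · exact disjoint_compl_right.mono_left subset_closure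
    · intro w hw
      by_cases hwc : w ∈ closure U
      · exact .inl (h w hw hwc)
      · exact .inr hwc
  have hwL : w ∈ L := by
    by_contra hwL
    obtain ⟨w', hw', hw'U⟩ := mem_closure_iff.1 hwc _
      (hLp.isClosed.isOpen_compl.connectedComponentIn (x := w)) (mem_connectedComponentIn hwL)
    exact hwU (subset_connectedComponentIn_of_inter isPreconnected_connectedComponentIn
      (connectedComponentIn_subset _ _) ⟨w', hw', hw'U⟩ (mem_connectedComponentIn hwL))
  have hwp : w ≠ p := fun h => hpU (h ▸ hwc)
  obtain ⟨u, hu, hwu⟩ : ∃ u ∈ s, w ∈ A u := by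
    rcases hwL with h | h | h
    · exact (hFK hwF h).elim
    · exact (hwp h).elim
    · simpa using h
  obtain ⟨⟨-, γ, hc, hi, h0, h1, hr⟩, hAF⟩ := hA u hu
  set T := γ '' Ioo 0 1
  have hT : ∀ z, z ∈ T ↔ z ∈ A u ∧ z ≠ u ∧ z ≠ p := by
    intro z
    constructor
    · rintro ⟨t, ht, rfl⟩
      exact ⟨hr ▸ mem_range_self _, h0 ▸ hi.ne ht.1.ne', h1 ▸ hi.ne ht.2.ne⟩
    · rintro ⟨hz, hzu, hzp⟩
      obtain ⟨t, rfl⟩ := hr.symm ▸ hz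
      refine ⟨t, ⟨lt_of_le_of_ne t.2.1 ?_, lt_of_le_of_ne t.2.2 ?_⟩, rfl⟩
      · rintro h
        exact hzu (h0 ▸ congrArg γ h.symm)
      · rintro h
        exact hzp (h1 ▸ congrArg γ h)
  have hTF : T ⊆ F := fun z hz => (hAF ((hT z).1 hz).1).resolve_left ((hT z).1 hz).2.1
  have hlocal : ∀ z ∈ T, z ∈ closure U → ∃ O, IsOpen O ∧ z ∈ O ∧ O ∩ T ⊆ closure U := by
    intro z hz hzU
    have hzA := (hT z).1 hz
    -- `M` is the rest of `L`, with `p` included. It is closed and misses `z`, so near `z` the set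
    -- `L` is just the arc `A u`.
    set M := K ∪ ({p} ∪ ⋃ v ∈ s.erase u, A v)
    have hM : IsClosed M := (hK.union ((isPolygonal_singleton p).union
      (IsPolygonal.biUnion _ A fun v hv => (hA v (Finset.mem_of_mem_erase hv)).1.1))).isClosed
    have hzM : z ∉ M := by
      rintro (h | h | h)
      · exact hFK (hTF hz) h
      · exact hzA.2.2 h
      · simp only [Finset.mem_erase, mem_iUnion, exists_prop] at h
        obtain ⟨v, ⟨hvu, hv⟩, hzv⟩ := h
        exact hzA.2.2 (hdisj u hu v hv hvu.symm ⟨hzA.1, hzv⟩)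
    obtain ⟨r, hr0, hball⟩ := Metric.mem_nhds_iff.1
      ((hLp.locally_conic z).and (hM.isOpen_compl.mem_nhds hzM))
    have hAL : A u ⊆ L := fun w hw => .inr (.inr (by simpa using ⟨u, hu, hw⟩))
    refine ⟨Metric.ball z r, Metric.isOpen_ball, Metric.mem_ball_self hr0, fun w' hw' => ?_⟩
    refine mem_closure_of_locally_arc hc hi (hr ▸ hzA.1) ?_ (fun w hw => (hball hw).1) hUL ?_
      hr0 hzU (hAL hzA.1) hw'.1 (hAL ((hT w').1 hw'.2).1)
    · intro w hw hwL
      rw [hr]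
      by_contra hwA
      apply (hball hw).2
      rcases hwL with h | h | h
      · exact .inl h
      · exact .inr (.inl h)
      · simp only [mem_iUnion, exists_prop] at h
        obtain ⟨v, hv, hwv⟩ := h
        refine .inr (.inr ?_)
        simp only [Finset.mem_erase, mem_iUnion, exists_prop]
        exact ⟨v, ⟨fun h => hwA (h ▸ hwv), hv⟩, hwv⟩
    · exact fun C hC hCL h => subset_connectedComponentIn_of_inter hC hCL h
  have hTc : IsPreconnected T := isPreconnected_Ioo.image γ hc.continuousOn
  have hwT : w ∈ T := (hT w).2 ⟨hwu, fun h => hFK hwF (h ▸ hs u hu), hwp⟩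
  -- The part of the open arc `T` in `closure U` is relatively closed, relatively open by `hlocal`,
  -- and contains `w`; connectedness gives all of `T`, whose closure contains `p`.
  have hTU : T ⊆ closure U := by
    let V : Set Plane := ⋃₀ {O | IsOpen O ∧ O ∩ T ⊆ closure U}
    by_contra hTU
    obtain ⟨z, hzT, hzU⟩ := not_subset.1 hTU
    obtain ⟨z', hz'T, ⟨O, hO, hz'O⟩, hz'⟩ := hTc V (closure U)ᶜ (isOpen_sUnion fun O hO => hO.1)
      isClosed_closure.isOpen_compl
      (by
        intro z hz
        by_cases hzU : z ∈ closure U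
        · obtain ⟨O, hO, hzO, hOT⟩ := hlocal z hz hzU
          exact .inl ⟨O, ⟨hO, hOT⟩, hzO⟩
        · exact .inr hzU)
      (by
        obtain ⟨O, hO, hzO, hOT⟩ := hlocal w hwT hwc
        exact ⟨w, hwT, O, ⟨hO, hOT⟩, hzO⟩)
      ⟨z, hzT, hzU⟩
    exact hz' (hO.2 ⟨hz'O, hz'T⟩)
  refine hpU (closure_minimal hTU isClosed_closure (image_closure_subset_closure_image hc
    ⟨1, ?_, h1⟩))
  rw [closure_Ioo zero_ne_one]
  exact ⟨zero_le_one, le_rfl⟩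

/-- A point of a face of a polygonal set can be joined to finitely many boundary points of this
face by arcs inside the face that have only this point in common. -/
theorem exists_star {K : Set Plane} (hK : IsPolygonal K) {x p : Plane}
    (hp : p ∈ connectedComponentIn Kᶜ x) (s : Finset Plane)
    (hs : ∀ v ∈ s, v ∈ K ∧ v ∈ closure (connectedComponentIn Kᶜ x)) :
    ∃ A : Plane → Set Plane,
      (∀ v ∈ s, IsArcBetween (A v) v p ∧ A v ⊆ insert v (connectedComponentIn Kᶜ x)) ∧
      ∀ u ∈ s, ∀ v ∈ s, u ≠ v → A u ∩ A v ⊆ {p} := by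
  induction s using Finset.induction_on with
  | empty => exact ⟨fun _ => ∅, by simp, by simp⟩
  | insert a s has ih =>
    obtain ⟨A, hA, hdisj⟩ := ih fun v hv => hs v (Finset.mem_insert_of_mem hv)
    obtain ⟨haK, haF⟩ := hs a (Finset.mem_insert_self a s)
    set F := connectedComponentIn Kᶜ x
    have hFK : F ⊆ Kᶜ := connectedComponentIn_subset _ _
    set S := {p} ∪ ⋃ v ∈ s, A v
    have hSp : IsPolygonal S :=
      (isPolygonal_singleton p).union (IsPolygonal.biUnion s A fun v hv => (hA v hv).1.1)
    have hLp : IsPolygonal (K ∪ S) := hK.union hSp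
    have hap : a ≠ p := fun h => hFK hp (h ▸ haK)
    have haA : ∀ v ∈ s, a ∉ A v := by
      intro v hv h
      rcases (hA v hv).2 h with rfl | h
      · exact has hv
      · exact hFK h haK
    have haS : a ∉ S := by
      rintro (h | h)
      · exact hap h
      · simp only [mem_iUnion, exists_prop] at h
        obtain ⟨v, hv, h⟩ := h
        exact haA v hv h
    -- The choice of `y` selects a component `U` that can be reached from `a` along a segment; the
    -- star's centre is on its boundary too, which yields `y'` near `p`.
    obtain ⟨y, ⟨hya, hyS⟩, hyF⟩ := mem_closure_iff_nhds.1 haF _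
      ((hLp.locally_conic a).and (hSp.isClosed.isOpen_compl.mem_nhds haS))
    have hyL : y ∉ K ∪ S := fun h => h.elim (hFK hyF) hyS
    set U := connectedComponentIn (K ∪ S)ᶜ y
    have hyU : y ∈ U := mem_connectedComponentIn hyL
    have hUL : U ⊆ (K ∪ S)ᶜ := connectedComponentIn_subset _ _
    have hUF : U ⊆ F := subset_connectedComponentIn_of_inter isPreconnected_connectedComponentIn
      (hUL.trans (compl_subset_compl.2 subset_union_left)) ⟨y, hyU, hyF⟩
    obtain ⟨y', hy'p, hy'U⟩ := mem_closure_iff_nhds.1 (center_mem_closure_component hK hp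
      (fun v hv => (hs v (Finset.mem_insert_of_mem hv)).1) hA hdisj hyF hyL) _
      (hLp.locally_conic p)
    have hpath : Relation.ReflTransGen
        (fun x y => segment ℝ x y ⊆ insert a (insert p U)) a p := by
      have hUW : U ⊆ insert a (insert p U) := (subset_insert _ _).trans (subset_insert _ _)
      refine .trans (.single ((segment_subset_insert_connectedComponentIn hya hyU).trans
        (insert_subset_insert (subset_insert _ _)))) (.trans (b := y') ?_ (.single ?_))
      · exact Relation.ReflTransGen.mono (fun _ _ h => h.trans hUW) _ _
          (isPreconnected_connectedComponentIn.reflTransGen_segment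
            hLp.isClosed.isOpen_compl.connectedComponentIn hyU hy'U)
      · rw [segment_symm]
        exact (segment_subset_insert_connectedComponentIn hy'p hy'U).trans (subset_insert _ _)
    obtain ⟨B, hBW, hB⟩ := exists_polyArc_of_reflTransGen hpath hap
    -- Apart from `a` and `p`, the new arc stays in `U`, which avoids the old arcs.
    have hBA : ∀ v ∈ s, B ∩ A v ⊆ {p} := by
      rintro v hv z ⟨hzB, hzv⟩
      rcases hBW hzB with rfl | rfl | h
      · exact (haA v hv hzv).elim
      · rfl
      · exact (hUL h (.inr (.inr (by simpa using ⟨v, hv, hzv⟩)))).elim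
    have hne : ∀ v ∈ s, v ≠ a := fun v hv h => has (h ▸ hv)
    refine ⟨Function.update A a B, ?_, ?_⟩
    · intro v hv
      rcases Finset.mem_insert.1 hv with rfl | hv
      · rw [Function.update_self]
        exact ⟨hB.isArcBetween, hBW.trans (insert_subset_insert (insert_subset hp hUF))⟩
      · rw [Function.update_of_ne (hne v hv)]
        exact hA v hv
    · intro u hu v hv huv
      rcases Finset.mem_insert.1 hu with rfl | hu' <;> rcases Finset.mem_insert.1 hv with rfl | hv'
      · exact (huv rfl).elim
      · rw [Function.update_self, Function.update_of_ne (hne v hv')]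
        exact hBA v hv'
      · rw [Function.update_self, Function.update_of_ne (hne u hu'), inter_comm]
        exact hBA u hu'
      · rw [Function.update_of_ne (hne u hu'), Function.update_of_ne (hne v hv')]
        exact hdisj u hu' v hv' huv

/-! ### The drawing of the join -/

theorem Drawing.isPolygonal_planarizationPoints {V : Type*} [Finite V] {G : SimpleGraph V}
    (D : Drawing G) : IsPolygonal D.planarizationPoints := by
  classical
  have := Fintype.ofFinite V
  have := Fintype.ofFinite G.edgeSet
  have hV := IsPolygonal.biUnion Finset.univ (fun v => {D.pos v}) fun v _ =>
    isPolygonal_singleton (D.pos v)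
  have hE := IsPolygonal.biUnion Finset.univ D.arc fun e _ => by
    obtain ⟨e, he⟩ := e
    induction e with
    | _ u v => exact (D.isArc u v he).1
  convert hV.union hE using 1
  rw [D.planarizationPoints_eq]
  ext z
  simp [eq_comm]

/-- The arc of an edge of the join in the extension of a drawing `D` of `G` by a star `A`. -/
def joinArc {V W : Type*} {G : SimpleGraph V} (D : Drawing G) (A : Plane → Set Plane)
    (e : Sym2 (V ⊕ W)) : Set Plane :=
  {z | (∃ f : G.edgeSet, Sym2.map Sum.inl f.1 = e ∧ z ∈ D.arc f) ∨
    ∃ v i, s(Sum.inl v, Sum.inr i) = e ∧ z ∈ A (D.pos v)}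

theorem joinArc_map_inl {V W : Type*} {G : SimpleGraph V} (D : Drawing G) (A : Plane → Set Plane)
    (f : G.edgeSet) : joinArc (W := W) D A (Sym2.map Sum.inl f.1) = D.arc f := by
  ext z
  constructor
  · rintro (⟨f', hf', hz⟩ | ⟨v, i, h, hz⟩)
    · exact Subtype.ext (Sym2.map.injective Sum.inl_injective hf') ▸ hz
    · obtain ⟨e, he⟩ := f
      induction e with
      | _ u v => simp at h
  · exact fun hz => .inl ⟨f, rfl, hz⟩

theorem joinArc_inl_inr {V W : Type*} {G : SimpleGraph V} (D : Drawing G) (A : Plane → Set Plane)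
    (v : V) (i : W) : joinArc D A s(Sum.inl v, Sum.inr i) = A (D.pos v) := by
  ext z
  constructor
  · rintro (⟨⟨e, he⟩, hf', hz⟩ | ⟨u, j, h, hz⟩)
    · induction e with
      | _ u v => simp at hf'
    · have : u = v := by simpa using congrArg (Sum.inl u ∈ ·) h
      exact this ▸ hz
  · exact fun hz => .inr ⟨v, i, rfl, hz⟩

theorem edge_graphJoin_pathGraph_one {V : Type*} {G : SimpleGraph V}
    (e : (graphJoin G (SimpleGraph.pathGraph 1)).edgeSet) :
    (∃ f : G.edgeSet, e.1 = Sym2.map Sum.inl f.1) ∨ ∃ v, e.1 = s(Sum.inl v, Sum.inr 0) := by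
  obtain ⟨e, he⟩ := e
  induction e with
  | _ a b =>
    rcases a with a | a <;> rcases b with b | b
    · exact .inl ⟨⟨s(a, b), by simpa [graphJoin] using he⟩, rfl⟩
    · exact .inr ⟨a, by rw [Subsingleton.elim b 0]⟩
    · exact .inr ⟨b, by simp only [Sym2.eq_swap, Subsingleton.elim a 0]⟩
    · rw [Subsingleton.elim a b] at he
      exact ((graphJoin G (SimpleGraph.pathGraph 1)).loopless.irrefl _ he).elim

theorem mainTheorem11 {V : Type*} [Finite V] (G : SimpleGraph V)
    (hG : IsOuterOnePlanarGraph G) :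
    IsOnePlanarGraph (graphJoin G (SimpleGraph.pathGraph 1)) := by
  classical
  have := Fintype.ofFinite V
  obtain ⟨D, hD, F, ⟨⟨p, hpK, rfl⟩, -⟩, hF⟩ := hG
  set K := D.planarizationPoints with hKdef
  have hp : p ∈ connectedComponentIn Kᶜ p := mem_connectedComponentIn hpK
  have hFK : connectedComponentIn Kᶜ p ⊆ Kᶜ := connectedComponentIn_subset _ _
  have hposK : ∀ v, D.pos v ∈ K := fun v => .inl (.inl (mem_range_self v))
  have harcK : ∀ e, D.arc e ⊆ K := fun e => by
    rw [hKdef, D.planarizationPoints_eq]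
    exact subset_union_of_subset_right (subset_iUnion _ e) _
  obtain ⟨A, hA, hdisj⟩ := exists_star D.isPolygonal_planarizationPoints hp
    (Finset.univ.image D.pos) (by
      intro v hv
      obtain ⟨v, -, rfl⟩ := Finset.mem_image.1 hv
      exact ⟨hposK v, frontier_subset_closure (hF v)⟩)
  replace hdisj : ∀ u v, u ≠ v → A (D.pos u) ∩ A (D.pos v) ⊆ {p} := fun u v h =>
    hdisj _ (by simp) _ (by simp) (D.pos_injective.ne h)
  replace hA : ∀ v, IsArcBetween (A (D.pos v)) (D.pos v) p ∧
      A (D.pos v) ⊆ insert (D.pos v) (connectedComponentIn Kᶜ p) := fun v => hA _ (by simp)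
  -- An arc of the star meets the old drawing only at its end vertex, since the rest of it lies in
  -- the face.
  have hAK : ∀ v, ∀ z ∈ A (D.pos v), z ∈ K → z = D.pos v := fun v z hz hzK =>
    ((hA v).2 hz).resolve_right fun h => hFK h hzK
  let D' : Drawing (graphJoin G (SimpleGraph.pathGraph 1)) :=
    { pos := Sum.elim D.pos fun _ => p
      arc := fun e => joinArc D A e.1
      pos_injective := by
        rintro (u | i) (v | j) h
        · exact congrArg _ (D.pos_injective h)
        · exact (hpK ((show D.pos u = p from h) ▸ hposK u)).elim
        · exact (hpK ((show p = D.pos v from h) ▸ hposK v)).elim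
        · rw [Subsingleton.elim i j]
      isArc := by
        rintro (u | i) (v | j) h
        · have h' : G.Adj u v := by simpa [graphJoin] using h
          simpa [← joinArc_map_inl (W := Fin 1) D A] using D.isArc u v h'
        · rw [joinArc_inl_inr]
          exact (hA u).1
        · simp only [Sym2.eq_swap (a := Sum.inr i)]
          rw [joinArc_inl_inr]
          exact (hA v).1.symm
        · rw [Subsingleton.elim i j] at h
          exact ((graphJoin G (SimpleGraph.pathGraph 1)).loopless.irrefl _ h).elim
      vertex_on_arc := by
        intro e v hv
        rcases edge_graphJoin_pathGraph_one e with ⟨f, hf⟩ | ⟨u, hu⟩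
        · rw [hf, joinArc_map_inl] at hv
          rw [hf]
          rcases v with v | i
          · exact Sym2.mem_map.2 ⟨v, D.vertex_on_arc f v hv, rfl⟩
          · exact (hpK (harcK f hv)).elim
        · rw [hu, joinArc_inl_inr] at hv
          rw [hu]
          rcases v with v | i
          · rw [D.pos_injective (hAK u _ hv (hposK v))]
            exact Sym2.mem_mk_left _ _
          · rw [Subsingleton.elim i 0]
            exact Sym2.mem_mk_right _ _ }
  have harc : ∀ e, D'.arc e = joinArc D A e.1 := fun _ => rfl
  have hinner : ∀ e (f : G.edgeSet), e.1 = Sym2.map Sum.inl f.1 → D'.inner e = D.inner f := by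
    intro e f h
    have : D'.pos '' {v | v ∈ e.1} = D.pos '' {v | v ∈ f.1} := by
      ext z
      simp only [h, Sym2.mem_map, mem_image, mem_ofPred_eq]
      constructor
      · rintro ⟨_, ⟨v, hv, rfl⟩, rfl⟩
        exact ⟨v, hv, rfl⟩
      · rintro ⟨v, hv, rfl⟩
        exact ⟨_, ⟨v, hv, rfl⟩, rfl⟩
    rw [Drawing.inner, Drawing.inner, this, harc, h, joinArc_map_inl]
  have hnew : ∀ e v, e.1 = s(Sum.inl v, Sum.inr 0) → ∀ z ∈ D'.inner e,
      z ∈ A (D.pos v) ∧ z ∉ K ∧ z ≠ p := by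
    intro e v h z hz
    have hzA : z ∈ A (D.pos v) := by
      have := hz.1
      rwa [harc, h, joinArc_inl_inr] at this
    refine ⟨hzA, fun hzK => hz.2 ⟨Sum.inl v, ?_, (hAK v z hzA hzK).symm⟩,
      fun hzp => hz.2 ⟨Sum.inr 0, ?_, hzp.symm⟩⟩
    · rw [mem_ofPred_eq, h]
      exact Sym2.mem_mk_left _ _
    · rw [mem_ofPred_eq, h]
      exact Sym2.mem_mk_right _ _
  -- Every crossing is an old one: interiors of new edges avoid `K`, and two new arcs share only
  -- `p`, which is an end of both.
  have hcross : ∀ e e' z, D'.CrossAt e e' z → ∃ f f' : G.edgeSet, e.1 = Sym2.map Sum.inl f.1 ∧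
      e'.1 = Sym2.map Sum.inl f'.1 ∧ D.CrossAt f f' z := by
    rintro e e' z ⟨hne, hz, hz'⟩
    rcases edge_graphJoin_pathGraph_one e with ⟨f, hf⟩ | ⟨u, hu⟩ <;>
      rcases edge_graphJoin_pathGraph_one e' with ⟨f', hf'⟩ | ⟨u', hu'⟩
    · refine ⟨f, f', hf, hf', ?_, hinner e f hf ▸ hz, hinner e' f' hf' ▸ hz'⟩
      rintro rfl
      exact hne (Subtype.ext (hf.trans hf'.symm))
    · rw [hinner e f hf] at hz
      exact ((hnew e' u' hu' z hz').2.1 (harcK f hz.1)).elim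
    · rw [hinner e' f' hf'] at hz'
      exact ((hnew e u hu z hz).2.1 (harcK f' hz'.1)).elim
    · have h := hnew e u hu z hz
      have h' := hnew e' u' hu' z hz'
      refine (h.2.2 (hdisj u u' ?_ ⟨h.1, h'.1⟩)).elim
      rintro rfl
      exact hne (Subtype.ext (hu.trans hu'.symm))
  have hinj := Sym2.map.injective (Sum.inl_injective (α := V) (β := Fin 1))
  refine ⟨D', ?_, ?_⟩
  · intro e e' v hv hv' z hz
    obtain ⟨f, f', hf, hf', hc⟩ := hcross e e' z hz
    rw [hf, Sym2.mem_map] at hv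
    rw [hf', Sym2.mem_map] at hv'
    obtain ⟨u, hu, rfl⟩ := hv
    obtain ⟨u', hu', h⟩ := hv'
    rw [Sum.inl_injective h] at hu'
    exact hD.adjacent_not_cross f f' u hu hu' z hc
  · intro e e' e'' z z' hz hz'
    obtain ⟨f, f', hf, hf', hc⟩ := hcross e e' z hz
    obtain ⟨g, g', hg, hg', hc'⟩ := hcross e e'' z' hz'
    obtain rfl : f = g := Subtype.ext (hinj (hf.symm.trans hg))
    obtain ⟨rfl, rfl⟩ := hD.crossed_at_most_once f f' g' z z' hc hc'
    exact ⟨Subtype.ext (hf'.trans hg'.symm), rfl⟩
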